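/- All Hilbert spaces are finite-dimensional complex Hilbert spaces. A quantum channel is a linear, completely positive, trace-preserving map $\mathcal N\colon\mathcal B(\mathcal H_A)\to\mathcal B(\mathcal H_B)$. An isometric extension of $\mathcal N$ is an isometry $V\colon\mathcal H_A\to\mathcal H_B\otimes\mathcal H_E$ with $\mathcal N(\rho)=\operatorname{tr}_E(V\rho V^\dagger)$, and the complementary channel with respect to $V$ is $\mathcal N^c(\rho)=\operatorname{tr}_B(V\rho V^\dagger)$, $\mathcal N^c\colon\mathcal B(\mathcal H_A)\to\mathcal B(\mathcal H_E)$. With $\|M\|_1=\operatorname{tr}\sqrt{M^\dagger M}$, the diamond norm of a linear map $\Phi\colon\mathcal B(\mathcal H)\to\mathcal B(\mathcal K)$ is $$\|\Phi\|_\diamond=\sup\{\|(\mathrm{id}_{\mathbb C^n}\otimes\Phi)(M)\|_1 : n\in\mathbb N,\ M\in\mathcal B(\mathbb C^n\otimes\mathcal H),\ \|M\|_1=1\}.$$ The channel $\mathcal N$ is called $\eta$-degradable (with respect to $\mathcal N^c$) if there is a quantum channel $\mathcal M\colon\mathcal B(\mathcal H_B)\to\mathcal B(\mathcal H_E)$ with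 $\|\mathcal N^c-\mathcal M\circ\mathcal N\|_\diamond\le\eta$; the degradability parameter $\mathrm{dg}(\mathcal N)$ is the infimum of all such $\eta$. Theorem. Let $\varepsilon\in[0,2]$ and let $\mathcal N\colon\mathcal B(\mathcal H_A)\to\mathcal B(\mathcal H_A)$ be a quantum channel with $\|\mathcal N-\mathrm{id}\|_\diamond\le\varepsilon$. Then, for every isometric extension of $\mathcal N$, the corresponding complementary channel $\mathcal N^c$ is a quantum channel and $$\|\mathcal N^c-\mathcal N^c\circ\mathcal N\|_\diamond\le 2\varepsilon^{3/2}.$$ Consequently $\mathcal N$ is $2\varepsilon^{3/2}$-degradable, with $\mathcal N^c$ as an approximate degrading map, and $\mathrm{dg}(\mathcal N)\le 2\varepsilon^{3/2}$. -/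

import Mathlib

open scoped Matrix MatrixOrder ComplexOrder ENNReal

noncomputable section

/-- The trace norm `‖M‖₁ = tr √(M† M)` (the trace is a nonnegative real number). -/
def traceNorm {m : Type*} [Fintype m] [DecidableEq m] (M : Matrix m m ℂ) : ℝ :=
  (CFC.sqrt (Mᴴ * M)).trace.re

/-- The map `id_{ℂⁿ} ⊗ Φ`: a matrix on `ℂⁿ ⊗ H` is an `n × n` block matrix with entries in `B(H)`,
and `Φ` is applied to each block. -/
def ampliation {a b : Type*} (n : ℕ)
    (Φ : Matrix a a ℂ →ₗ[ℂ] Matrix b b ℂ) (M : Matrix (Fin n × a) (Fin n × a) ℂ) :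
    Matrix (Fin n × b) (Fin n × b) ℂ :=
  Matrix.of fun x y => Φ (Matrix.of fun p q => M (x.1, p) (y.1, q)) x.2 y.2

/-- The diamond norm: the supremum of `‖(id_{ℂⁿ} ⊗ Φ)(M)‖₁` over all `n` and all `M` with
`‖M‖₁ = 1`. It takes values in `[0, ∞]`, so that no boundedness is presupposed. -/
def diamondNorm {a b : Type*} [Fintype a] [DecidableEq a] [Fintype b] [DecidableEq b]
    (Φ : Matrix a a ℂ →ₗ[ℂ] Matrix b b ℂ) : ℝ≥0∞ :=
  ⨆ (n : ℕ) (M : Matrix (Fin n × a) (Fin n × a) ℂ) (_ : traceNorm M = 1),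
    ENNReal.ofReal (traceNorm (ampliation n Φ M))

/-- A quantum channel: a linear, completely positive, trace-preserving map. -/
structure IsQuantumChannel {a b : Type*} [Fintype a] [Fintype b]
    (Φ : Matrix a a ℂ →ₗ[ℂ] Matrix b b ℂ) : Prop where
  completelyPositive : ∀ (n : ℕ) (M : Matrix (Fin n × a) (Fin n × a) ℂ),
    M.PosSemidef → (ampliation n Φ M).PosSemidef
  tracePreserving : ∀ M : Matrix a a ℂ, (Φ M).trace = M.trace

/-- The partial trace `tr_E : B(H_B ⊗ H_E) → B(H_B)` over the second factor. -/
def partialTraceSnd {b e : Type*} [Fintype e] (X : Matrix (b × e) (b × e) ℂ) : Matrix b b ℂ :=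
  Matrix.of fun i j => ∑ k, X (i, k) (j, k)

/-- The partial trace `tr_B : B(H_B ⊗ H_E) → B(H_E)` over the first factor. -/
def partialTraceFst {b e : Type*} [Fintype b] (X : Matrix (b × e) (b × e) ℂ) : Matrix e e ℂ :=
  Matrix.of fun k l => ∑ i, X (i, k) (i, l)

/-- `V : H_A → H_B ⊗ H_E` is an isometric extension (Stinespring dilation) of `N`: it is an isometry
and `N ρ = tr_E (V ρ V†)`. -/
structure IsIsometricExtension {a b e : Type*} [Fintype a] [DecidableEq a] [Fintype b] [Fintype e]
    (N : Matrix a a ℂ →ₗ[ℂ] Matrix b b ℂ) (V : Matrix (b × e) a ℂ) : Prop where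
  isometry : Vᴴ * V = 1
  dilation : ∀ ρ : Matrix a a ℂ, N ρ = partialTraceSnd (V * ρ * Vᴴ)

/-- The complementary channel `ρ ↦ tr_B (V ρ V†)` with respect to an isometric extension `V`. -/
def complementaryChannel {a b e : Type*} [Fintype a] [Fintype b]
    (V : Matrix (b × e) a ℂ) : Matrix a a ℂ →ₗ[ℂ] Matrix e e ℂ where
  toFun ρ := partialTraceFst (V * ρ * Vᴴ)
  map_add' ρ σ := by
    ext k l
    simp [partialTraceFst, Matrix.mul_add, Matrix.add_mul, Finset.sum_add_distrib]
  map_smul' c ρ := by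
    ext k l
    simp [partialTraceFst, Finset.mul_sum]

/-- `N : A → B`, with complementary channel `Nc : A → E`, is `η`-degradable: there is a quantum
channel `D : B → E` with `‖Nc - D ∘ N‖_⋄ ≤ η`. -/
def IsApproxDegradable {a b e : Type*} [Fintype a] [DecidableEq a] [Fintype b]
    [Fintype e] [DecidableEq e]
    (N : Matrix a a ℂ →ₗ[ℂ] Matrix b b ℂ) (Nc : Matrix a a ℂ →ₗ[ℂ] Matrix e e ℂ)
    (η : ℝ≥0∞) : Prop :=
  ∃ D : Matrix b b ℂ →ₗ[ℂ] Matrix e e ℂ,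
    IsQuantumChannel D ∧ diamondNorm (Nc - D ∘ₗ N) ≤ η

/-- The degradability parameter `dg(N)`: the smallest `η` such that `N` is `η`-degradable. -/
def degradabilityParameter {a b e : Type*} [Fintype a] [DecidableEq a] [Fintype b]
    [Fintype e] [DecidableEq e]
    (N : Matrix a a ℂ →ₗ[ℂ] Matrix b b ℂ) (Nc : Matrix a a ℂ →ₗ[ℂ] Matrix e e ℂ) : ℝ≥0∞ :=
  sInf {η : ℝ≥0∞ | IsApproxDegradable N Nc η}

end

/-! If `N` is close to the identity, the environment learns almost nothing: `V` is within `√ε` in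
operator norm of `x ↦ x ⊗ ψ` for one fixed `ψ` (`exists_tensorVector_close`). The complementary map
of `x ↦ x ⊗ ψ` is `ρ ↦ tr ρ • ψψ†`, which annihilates `(N - id) ρ` because `N` preserves the trace.
Hence `Nᶜ - Nᶜ ∘ N = -(Nᶜ - Nᶜ_ψ) ∘ (N - id)`, and the two factors contribute `2√ε` and `ε`.

To find `ψ`, let `K_k` be the Kraus operators of `V`. Every state `ρ` has entanglement fidelity `∑
|tr (K_k ρ)|² ≥ 1 - ε/2`. The vectors `(tr (K_k ρ))_k` depend linearly on `ρ`, so they form a convex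
set, and its normalized point of least norm serves all states at once. This replaces a minimax
argument. -/

/-! ### Trace norm: duality with the operator norm. -/

section TraceNorm

open scoped Matrix.Norms.L2Operator

variable {m : Type*} [Fintype m] [DecidableEq m]

lemma traceNorm_eq_sum_sqrt_eigenvalues (M : Matrix m m ℂ) :
    traceNorm M =
      ∑ i, Real.sqrt ((Matrix.isHermitian_conjTranspose_mul_self M).eigenvalues i) := by
  have h0 : 0 ≤ Mᴴ * M :=
    Matrix.nonneg_iff_posSemidef.2 (Matrix.posSemidef_conjTranspose_mul_self M)
  rw [traceNorm, CFC.sqrt_eq_real_sqrt _ h0, cfcₙ_eq_cfc,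
    (Matrix.isHermitian_conjTranspose_mul_self M).cfc_eq, Matrix.IsHermitian.cfc,
    Unitary.conjStarAlgAut_apply, Matrix.trace_mul_cycle, Unitary.coe_star_mul_self, one_mul,
    Matrix.trace_diagonal]
  simp

lemma traceNorm_of_posSemidef {M : Matrix m m ℂ} (hM : M.PosSemidef) :
    traceNorm M = M.trace.re := by
  rw [traceNorm, hM.1.eq, CFC.sqrt_mul_self M (Matrix.nonneg_iff_posSemidef.2 hM)]

lemma traceNorm_neg (M : Matrix m m ℂ) : traceNorm (-M) = traceNorm M := by
  simp [traceNorm]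

/-- Hölder's inequality between the trace norm and the operator norm. -/
lemma norm_trace_mul_le (Z M : Matrix m m ℂ) : ‖(Z * M).trace‖ ≤ ‖Z‖ * traceNorm M := by
  -- Right singular vectors of `M` as basis: `‖M bᵢ‖` is then the `i`-th singular value.
  set hA := Matrix.isHermitian_conjTranspose_mul_self M
  set b := hA.eigenvectorBasis
  have htr : (Z * M).trace =
      ∑ i, inner ℂ (b i) (Matrix.toEuclideanCLM (n := m) (𝕜 := ℂ) Z
        (Matrix.toEuclideanCLM (n := m) (𝕜 := ℂ) M (b i))) := by
    have h := LinearMap.trace_eq_sum_inner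
      (Matrix.toEuclideanCLM (n := m) (𝕜 := ℂ) (Z * M)).toLinearMap b
    rw [Matrix.coe_toEuclideanCLM_eq_toEuclideanLin, Matrix.toEuclideanLin_eq_toLin_orthonormal,
      Matrix.trace_toLin_eq] at h
    rw [h]
    refine Finset.sum_congr rfl fun i _ => ?_
    congr 1
    rw [← mul_apply_eq_comp, ← map_mul, ← Matrix.toEuclideanLin_eq_toLin_orthonormal]
    rfl
  have hnorm : ∀ i, ‖Matrix.toEuclideanCLM (n := m) (𝕜 := ℂ) M (b i)‖ =
      Real.sqrt (hA.eigenvalues i) := fun i => by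
    rw [hA.eigenvalues_eq, EuclideanSpace.norm_eq]
    congr 1
    rw [← Matrix.mulVec_mulVec, Matrix.dotProduct_mulVec, Matrix.vecMul_conjTranspose, star_star]
    simp only [Matrix.ofLp_toEuclideanCLM, dotProduct, map_sum, Pi.star_apply, RCLike.star_def,
      RCLike.conj_mul]
    exact Finset.sum_congr rfl fun j _ => by norm_cast
  rw [htr, traceNorm_eq_sum_sqrt_eigenvalues, Finset.mul_sum]
  refine (norm_sum_le _ _).trans (Finset.sum_le_sum fun i _ => ?_)
  refine (norm_inner_le_norm _ _).trans ?_
  rw [b.norm_eq_one, one_mul, ← hnorm]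
  exact ContinuousLinearMap.le_opNorm _ _

/-- The trace norm is attained by pairing with a contraction. -/
lemma exists_trace_mul_eq_traceNorm (M : Matrix m m ℂ) :
    ∃ U : Matrix m m ℂ, ‖U‖ ≤ 1 ∧ (U * M).trace = traceNorm M := by
  set hA := Matrix.isHermitian_conjTranspose_mul_self M
  have h0 : 0 ≤ Mᴴ * M :=
    Matrix.nonneg_iff_posSemidef.2 (Matrix.posSemidef_conjTranspose_mul_self M)
  have hsa : IsSelfAdjoint (Mᴴ * M) := hA
  have hc : ∀ f : ℝ → ℝ, ContinuousOn f (spectrum ℝ (Mᴴ * M)) := fun f =>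
    (Matrix.finite_real_spectrum (A := Mᴴ * M)).continuousOn f
  have hsp : ∀ x ∈ spectrum ℝ (Mᴴ * M), 0 ≤ x := fun x hx => spectrum_nonneg_of_nonneg h0 hx
  -- Pseudo-inverse of `|M|`: since `0⁻¹ = 0`, it vanishes on the kernel. Thus `R * Mᴴ` is the
  -- adjoint of the polar part of `M`, a partial isometry.
  set R := cfc (fun x : ℝ => (Real.sqrt x)⁻¹) (Mᴴ * M) with hR
  have hRsa : Rᴴ = R := (cfc_predicate (fun x : ℝ => (Real.sqrt x)⁻¹) (Mᴴ * M))
  have hid : cfc (fun x : ℝ => x) (Mᴴ * M) = Mᴴ * M := cfc_id' ℝ _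
  have hRA : R * (Mᴴ * M) = cfc Real.sqrt (Mᴴ * M) := by
    rw [hR]
    nth_rw 2 [← hid]
    rw [← cfc_mul _ _ _ (hc _) (hc _)]
    refine cfc_congr fun x hx => ?_
    rcases (hsp x hx).eq_or_lt with rfl | hx
    · simp
    · have := Real.sqrt_pos.2 hx
      field_simp
      rw [Real.sq_sqrt hx.le]
  refine ⟨R * Mᴴ, ?_, ?_⟩
  · have h1 : ‖R * Mᴴ‖ * ‖R * Mᴴ‖ ≤ 1 := by
      rw [← Matrix.l2_opNorm_conjTranspose, ← Matrix.l2_opNorm_conjTranspose_mul_self,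
        Matrix.conjTranspose_conjTranspose, Matrix.conjTranspose_mul,
        Matrix.conjTranspose_conjTranspose, hRsa]
      have : R * Mᴴ * (M * R) = cfc (fun x : ℝ => Real.sqrt x * (Real.sqrt x)⁻¹) (Mᴴ * M) := by
        rw [cfc_mul _ _ _ (hc _) (hc _), ← hRA]
        simp only [Matrix.mul_assoc, hR]
      rw [this]
      refine norm_cfc_le zero_le_one fun x _ => ?_
      rw [Real.norm_eq_abs, abs_le]
      by_cases h : Real.sqrt x = 0
      · simp [h]
      · rw [mul_inv_cancel₀ h]; norm_num
    nlinarith [norm_nonneg (R * Mᴴ)]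
  · rw [Matrix.mul_assoc, hRA, traceNorm_eq_sum_sqrt_eigenvalues, hA.cfc_eq,
      Matrix.IsHermitian.cfc, Unitary.conjStarAlgAut_apply, Matrix.trace_mul_cycle,
      Unitary.coe_star_mul_self, one_mul, Matrix.trace_diagonal]
    simp

lemma traceNorm_nonneg (M : Matrix m m ℂ) : 0 ≤ traceNorm M := by
  rw [traceNorm_eq_sum_sqrt_eigenvalues]
  exact Finset.sum_nonneg fun i _ => Real.sqrt_nonneg _

lemma traceNorm_smul_le (c : ℂ) (M : Matrix m m ℂ) :
    traceNorm (c • M) ≤ ‖c‖ * traceNorm M := by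
  obtain ⟨U, hU, h⟩ := exists_trace_mul_eq_traceNorm (c • M)
  have h1 : ‖(traceNorm (c • M) : ℂ)‖ = traceNorm (c • M) := by
    rw [Complex.norm_real, Real.norm_of_nonneg (traceNorm_nonneg _)]
  rw [← h1, ← h, Matrix.mul_smul, Matrix.trace_smul, norm_smul]
  have h2 := norm_trace_mul_le U M
  have h3 := mul_le_mul_of_nonneg_right hU (traceNorm_nonneg M)
  exact mul_le_mul_of_nonneg_left (by linarith) (norm_nonneg c)

lemma traceNorm_smul (c : ℂ) (M : Matrix m m ℂ) : traceNorm (c • M) = ‖c‖ * traceNorm M := by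
  refine le_antisymm (traceNorm_smul_le c M) ?_
  rcases eq_or_ne c 0 with rfl | hc
  · simpa using traceNorm_nonneg (0 : Matrix m m ℂ)
  · have h := traceNorm_smul_le c⁻¹ (c • M)
    rw [smul_smul, inv_mul_cancel₀ hc, one_smul, norm_inv] at h
    have := norm_pos_iff.2 hc
    rwa [inv_mul_eq_div, le_div_iff₀' this] at h

lemma eq_zero_of_traceNorm_eq_zero {M : Matrix m m ℂ} (h : traceNorm M = 0) : M = 0 := by
  have h1 := norm_trace_mul_le Mᴴ M
  rw [h, mul_zero] at h1
  exact Matrix.trace_conjTranspose_mul_self_eq_zero_iff.1 (norm_le_zero_iff.1 h1)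

end TraceNorm

/-! ### Operator norm bounds through Euclidean norms. -/

section OperatorNorm

open scoped Matrix.Norms.L2Operator Kronecker

variable {m n : Type*} [Fintype m] [Fintype n] [DecidableEq n]

lemma l2_opNorm_le_of_sum_sq_le {T : Matrix m n ℂ} {c : ℝ} (hc : 0 ≤ c)
    (h : ∀ x : n → ℂ, ∑ i, ‖(T *ᵥ x) i‖ ^ 2 ≤ c ^ 2 * ∑ j, ‖x j‖ ^ 2) : ‖T‖ ≤ c := by
  rw [Matrix.l2_opNorm_def]
  refine ContinuousLinearMap.opNorm_le_bound _ hc fun x => ?_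
  refine (sq_le_sq₀ (norm_nonneg _) (by positivity)).1 ?_
  rw [mul_pow, EuclideanSpace.norm_sq_eq, EuclideanSpace.norm_sq_eq]
  exact h x

lemma sum_sq_mulVec_le (T : Matrix m n ℂ) (x : n → ℂ) :
    ∑ i, ‖(T *ᵥ x) i‖ ^ 2 ≤ ‖T‖ ^ 2 * ∑ j, ‖x j‖ ^ 2 := by
  have h := (sq_le_sq₀ (norm_nonneg _) (by positivity)).2
    (Matrix.l2_opNorm_mulVec T (WithLp.toLp 2 x))
  rwa [mul_pow, EuclideanSpace.norm_sq_eq, EuclideanSpace.norm_sq_eq] at h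

lemma l2_opNorm_kronecker_one_le {a : Type*} [Fintype a] [DecidableEq a] (U : Matrix n n ℂ) :
    ‖U ⊗ₖ (1 : Matrix a a ℂ)‖ ≤ ‖U‖ := by
  refine l2_opNorm_le_of_sum_sq_le (norm_nonneg _) fun x => ?_
  have hmul : ∀ p i, ((U ⊗ₖ (1 : Matrix a a ℂ)) *ᵥ x) (p, i) = (U *ᵥ fun q => x (q, i)) p := by
    intro p i
    simp [Matrix.mulVec, dotProduct, Fintype.sum_prod_type, Matrix.one_apply]
  rw [Fintype.sum_prod_type_right, Fintype.sum_prod_type_right, Finset.mul_sum]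
  refine Finset.sum_le_sum fun i _ => ?_
  simp only [hmul]
  exact sum_sq_mulVec_le U fun q => x (q, i)

end OperatorNorm

/-! ### Complementary channels and their continuity in the isometry. -/

section ComplementaryChannel

open scoped Matrix.Norms.L2Operator Kronecker

variable {a b e : Type*}

lemma ampliation_comp {c : Type*} (n : ℕ) (Φ : Matrix b b ℂ →ₗ[ℂ] Matrix c c ℂ)
    (Ψ : Matrix a a ℂ →ₗ[ℂ] Matrix b b ℂ) (M : Matrix (Fin n × a) (Fin n × a) ℂ) :
    ampliation n (Φ ∘ₗ Ψ) M = ampliation n Φ (ampliation n Ψ M) := rfl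

lemma ampliation_sub (n : ℕ) (Φ Ψ : Matrix a a ℂ →ₗ[ℂ] Matrix b b ℂ)
    (M : Matrix (Fin n × a) (Fin n × a) ℂ) :
    ampliation n (Φ - Ψ) M = ampliation n Φ M - ampliation n Ψ M := rfl

lemma ampliation_neg (n : ℕ) (Φ : Matrix a a ℂ →ₗ[ℂ] Matrix b b ℂ)
    (M : Matrix (Fin n × a) (Fin n × a) ℂ) :
    ampliation n (-Φ) M = -ampliation n Φ M := rfl

lemma ampliation_id (n : ℕ) (M : Matrix (Fin n × a) (Fin n × a) ℂ) :
    ampliation n LinearMap.id M = M := rfl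

lemma ampliation_smul (n : ℕ) (Φ : Matrix a a ℂ →ₗ[ℂ] Matrix b b ℂ) (c : ℂ)
    (M : Matrix (Fin n × a) (Fin n × a) ℂ) :
    ampliation n Φ (c • M) = c • ampliation n Φ M := by
  ext x y
  exact congrFun (congrFun (Φ.map_smul c _) x.2) y.2

/-- The operator `1_{ℂⁿ} ⊗ T`, with the tensor factors of the codomain ordered as
`(ℂⁿ ⊗ H_E) ⊗ H_B`. -/
def idTensor (n : ℕ) (T : Matrix (b × e) a ℂ) : Matrix ((Fin n × e) × b) (Fin n × a) ℂ :=
  Matrix.of fun x y => if x.1.1 = y.1 then T (x.2, x.1.2) y.2 else 0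

lemma idTensor_sub (n : ℕ) (S T : Matrix (b × e) a ℂ) :
    idTensor n (S - T) = idTensor n S - idTensor n T := by
  ext x y
  by_cases h : x.1.1 = y.1 <;> simp [idTensor, h]

lemma l2_opNorm_idTensor_le [Fintype a] [DecidableEq a] [Fintype b] [Fintype e] (n : ℕ)
    (T : Matrix (b × e) a ℂ) : ‖idTensor n T‖ ≤ ‖T‖ := by
  refine l2_opNorm_le_of_sum_sq_le (norm_nonneg _) fun x => ?_
  have hmul : ∀ r k i, (idTensor n T *ᵥ x) ((r, k), i) = (T *ᵥ fun j => x (r, j)) (i, k) := by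
    intro r k i
    simp [idTensor, Matrix.mulVec, dotProduct, Fintype.sum_prod_type]
  have h : ∑ p, ‖(idTensor n T *ᵥ x) p‖ ^ 2 =
      ∑ r, ∑ q, ‖(T *ᵥ fun j => x (r, j)) q‖ ^ 2 := by
    simp only [Fintype.sum_prod_type, hmul]
    exact Finset.sum_congr rfl fun r _ => Finset.sum_comm
  rw [h, Fintype.sum_prod_type, Finset.mul_sum]
  exact Finset.sum_le_sum fun r _ => sum_sq_mulVec_le T fun j => x (r, j)

/-- Placing `H_B` last in `idTensor` turns the trace over the first factor into one over the second,
so the ampliation again has Stinespring form. -/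
lemma ampliation_complementaryChannel [Fintype a] [Fintype b] (n : ℕ) (V : Matrix (b × e) a ℂ)
    (M : Matrix (Fin n × a) (Fin n × a) ℂ) :
    ampliation n (complementaryChannel V) M =
      partialTraceSnd (idTensor n V * M * (idTensor n V)ᴴ) := by
  ext ⟨r, k⟩ ⟨s, l⟩
  simp [ampliation, complementaryChannel, partialTraceFst, partialTraceSnd, idTensor,
    Matrix.mul_apply, Fintype.sum_prod_type, apply_ite]

lemma trace_mul_partialTraceSnd [Fintype b] [DecidableEq b] [Fintype e] (U : Matrix e e ℂ)
    (X : Matrix (e × b) (e × b) ℂ) :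
    (U * partialTraceSnd X).trace = ((U ⊗ₖ (1 : Matrix b b ℂ)) * X).trace := by
  simp only [Matrix.trace, Matrix.diag_apply, Matrix.mul_apply, partialTraceSnd, Matrix.of_apply,
    Fintype.sum_prod_type, Matrix.kroneckerMap_apply, Matrix.one_apply, mul_ite, mul_one, mul_zero,
    ite_mul, zero_mul, Finset.sum_ite_eq, Finset.mem_univ, if_true, Finset.mul_sum]
  exact Finset.sum_congr rfl fun i _ => Finset.sum_comm

lemma partialTraceSnd_posSemidef [Fintype e] {X : Matrix (b × e) (b × e) ℂ}
    (hX : X.PosSemidef) : (partialTraceSnd X).PosSemidef := by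
  have h : partialTraceSnd X = ∑ k, X.submatrix (fun i => (i, k)) (fun i => (i, k)) := by
    ext i j
    simp [partialTraceSnd, Matrix.sum_apply]
  rw [h]
  exact Matrix.posSemidef_sum _ fun k _ => hX.submatrix _

lemma isQuantumChannel_complementaryChannel [Fintype a] [DecidableEq a] [Fintype b] [Fintype e]
    {V : Matrix (b × e) a ℂ} (hV : Vᴴ * V = 1) : IsQuantumChannel (complementaryChannel V) where
  completelyPositive n M hM := by
    rw [ampliation_complementaryChannel]
    exact partialTraceSnd_posSemidef (hM.mul_mul_conjTranspose_same _)
  tracePreserving M := by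
    have h : (complementaryChannel V M).trace = (V * M * Vᴴ).trace := by
      simp only [complementaryChannel, LinearMap.coe_mk, AddHom.coe_mk, Matrix.trace,
        Matrix.diag_apply, partialTraceFst, Matrix.of_apply, Fintype.sum_prod_type]
      exact Finset.sum_comm
    rw [h, Matrix.trace_mul_cycle, hV, one_mul]

/-- The Heisenberg picture: the test operator moves to the input side, where Hölder's inequality
applies to `M` itself. -/
lemma trace_mul_ampliation_complementaryChannel [Fintype a] [Fintype b] [DecidableEq b]
    [Fintype e] (n : ℕ) (V : Matrix (b × e) a ℂ) (U : Matrix (Fin n × e) (Fin n × e) ℂ)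
    (M : Matrix (Fin n × a) (Fin n × a) ℂ) :
    (U * ampliation n (complementaryChannel V) M).trace =
      ((idTensor n V)ᴴ * (U ⊗ₖ (1 : Matrix b b ℂ)) * idTensor n V * M).trace := by
  rw [ampliation_complementaryChannel, trace_mul_partialTraceSnd, ← Matrix.mul_assoc,
    ← Matrix.mul_assoc, Matrix.trace_mul_comm]
  simp only [Matrix.mul_assoc]

/-- Contractions that are close in operator norm have complementary channels that are close in
diamond norm. -/
lemma traceNorm_ampliation_complementaryChannel_sub_le [Fintype a] [DecidableEq a] [Fintype b]
    [DecidableEq b] [Fintype e] [DecidableEq e] {V W : Matrix (b × e) a ℂ} {δ : ℝ}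
    (hV : ‖V‖ ≤ 1) (hW : ‖W‖ ≤ 1) (hVW : ‖V - W‖ ≤ δ) (n : ℕ)
    (M : Matrix (Fin n × a) (Fin n × a) ℂ) :
    traceNorm (ampliation n (complementaryChannel V - complementaryChannel W) M) ≤
      2 * δ * traceNorm M := by
  obtain ⟨U, hU, h⟩ := exists_trace_mul_eq_traceNorm
    (ampliation n (complementaryChannel V - complementaryChannel W) M)
  rw [ampliation_sub, Matrix.mul_sub, Matrix.trace_sub,
    trace_mul_ampliation_complementaryChannel, trace_mul_ampliation_complementaryChannel,
    ← Matrix.trace_sub, ← Matrix.sub_mul, ← ampliation_sub] at h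
  set S := idTensor n V
  set T := idTensor n W
  set Û := U ⊗ₖ (1 : Matrix b b ℂ)
  have hS : ‖S‖ ≤ 1 := (l2_opNorm_idTensor_le n V).trans hV
  have hT : ‖T‖ ≤ 1 := (l2_opNorm_idTensor_le n W).trans hW
  have hST : ‖S - T‖ ≤ δ := by
    rw [← idTensor_sub]
    exact (l2_opNorm_idTensor_le n _).trans hVW
  have hÛ : ‖Û‖ ≤ 1 := (l2_opNorm_kronecker_one_le U).trans hU
  have hδ : 0 ≤ δ := (norm_nonneg _).trans hVW
  have hprod : ∀ A B : Matrix ((Fin n × e) × b) (Fin n × a) ℂ, ∀ α β : ℝ,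
      ‖A‖ ≤ α → ‖B‖ ≤ β → ‖Aᴴ * Û * B‖ ≤ α * β := by
    intro A B α β hA hB
    have hα := (norm_nonneg _).trans hA
    calc ‖Aᴴ * Û * B‖ ≤ ‖Aᴴ * Û‖ * ‖B‖ := Matrix.l2_opNorm_mul _ _
      _ ≤ (‖Aᴴ‖ * ‖Û‖) * ‖B‖ :=
        mul_le_mul_of_nonneg_right (Matrix.l2_opNorm_mul _ _) (norm_nonneg _)
      _ ≤ (α * 1) * β := by
        rw [Matrix.l2_opNorm_conjTranspose]
        gcongr
      _ = α * β := by ring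
  -- Telescoping: each summand contains one difference of norm at most `δ`, whence the factor 2.
  have hsplit : Sᴴ * Û * S - Tᴴ * Û * T = Sᴴ * Û * (S - T) + (S - T)ᴴ * Û * T := by
    simp only [Matrix.conjTranspose_sub, Matrix.sub_mul, Matrix.mul_sub]
    abel
  have hZ : ‖Sᴴ * Û * S - Tᴴ * Û * T‖ ≤ 2 * δ := by
    rw [hsplit]
    refine (norm_add_le _ _).trans ?_
    linarith [hprod S (S - T) 1 δ hS hST, hprod (S - T) T δ 1 hST hT]
  have h1 := norm_trace_mul_le (Sᴴ * Û * S - Tᴴ * Û * T) M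
  rw [h, Complex.norm_real, Real.norm_of_nonneg (traceNorm_nonneg _)] at h1
  exact h1.trans (mul_le_mul_of_nonneg_right hZ (traceNorm_nonneg M))

lemma traceNorm_ampliation_le_of_diamondNorm_le [Fintype a] [DecidableEq a] [Fintype b]
    [DecidableEq b] {Φ : Matrix a a ℂ →ₗ[ℂ] Matrix b b ℂ} {ε : ℝ} (hε : 0 ≤ ε)
    (h : diamondNorm Φ ≤ ENNReal.ofReal ε) (n : ℕ) (M : Matrix (Fin n × a) (Fin n × a) ℂ) :
    traceNorm (ampliation n Φ M) ≤ ε * traceNorm M := by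
  have key : ∀ M : Matrix (Fin n × a) (Fin n × a) ℂ, traceNorm M = 1 →
      traceNorm (ampliation n Φ M) ≤ ε := by
    intro M hM
    have h1 : ENNReal.ofReal (traceNorm (ampliation n Φ M)) ≤ diamondNorm Φ :=
      le_iSup_of_le n (le_iSup_of_le M (le_iSup_of_le hM le_rfl))
    exact (ENNReal.ofReal_le_ofReal_iff hε).1 (h1.trans h)
  -- The bound extends from the unit sphere by homogeneity; only `M = 0` cannot be normalized.
  rcases (traceNorm_nonneg M).eq_or_lt with h0 | hpos
  · have hM : M = (0 : ℂ) • M := by rw [eq_zero_of_traceNorm_eq_zero h0.symm, smul_zero]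
    rw [hM, ampliation_smul, traceNorm_smul, traceNorm_smul]
    simp
  · have hc : ‖((traceNorm M)⁻¹ : ℂ)‖ = (traceNorm M)⁻¹ := by
      rw [norm_inv, Complex.norm_real, Real.norm_of_nonneg hpos.le]
    have h1 := key (((traceNorm M)⁻¹ : ℂ) • M)
      (by rw [traceNorm_smul, hc, inv_mul_cancel₀ hpos.ne'])
    rwa [ampliation_smul, traceNorm_smul, hc, inv_mul_le_iff₀ hpos, mul_comm] at h1

end ComplementaryChannel

/-! ### The point of least norm in a convex set. -/

section MinimalNorm

/-- If every point of a nonempty convex set has squared norm at least `c ∈ [0, 1]`, then a single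
vector of the unit ball has inner product at least `c` with all of its points. -/
lemma exists_norm_le_one_forall_le_inner {F : Type*} [NormedAddCommGroup F]
    [InnerProductSpace ℝ F] [CompleteSpace F] {X : Set F} (hne : X.Nonempty) (hX : Convex ℝ X)
    {c : ℝ} (hc1 : c ≤ 1) (h : ∀ x ∈ X, c ≤ ‖x‖ ^ 2) :
    ∃ ψ : F, ‖ψ‖ ≤ 1 ∧ ∀ x ∈ X, c ≤ inner ℝ ψ x := by
  -- `v` is the projection of 0 onto the closure; its variational inequality gives `‖v‖² ≤ ⟪v, x⟫`
  -- on `X`.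
  obtain ⟨v, hv, hmin⟩ := exists_norm_eq_iInf_of_complete_convex hne.closure
    isClosed_closure.isComplete hX.closure 0
  have hinner := (norm_eq_iInf_iff_real_inner_le_zero hX.closure hv).1 hmin
  have hcv : c ≤ ‖v‖ ^ 2 :=
    closure_minimal (t := {x : F | c ≤ ‖x‖ ^ 2}) h
      (isClosed_le continuous_const (by fun_prop)) hv
  have hle : ∀ x ∈ X, ‖v‖ ^ 2 ≤ inner ℝ v x := by
    intro x hx
    have h1 := hinner x (subset_closure hx)
    rw [zero_sub, inner_neg_left, inner_sub_right, real_inner_self_eq_norm_sq] at h1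
    linarith
  refine ⟨‖v‖⁻¹ • v, ?_, fun x hx => ?_⟩
  · rw [norm_smul, norm_inv, norm_norm]
    exact inv_mul_le_one
  · rw [real_inner_smul_left]
    rcases (norm_nonneg v).eq_or_lt with h0 | hpos
    · rw [← h0] at hcv ⊢
      simpa using hcv
    · have h2 := hle x hx
      rw [inv_mul_eq_div, le_div_iff₀ hpos]
      rcases le_total c 0 with hc | hc
      · nlinarith
      -- Here `c ≤ 1` enters: `‖v‖ < c ≤ 1` would give `‖v‖² < c`.
      · have h3 : c ≤ ‖v‖ := by
          by_contra! hlt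
          nlinarith
        nlinarith

end MinimalNorm

/-! ### The ideal isometric extension, with a fixed environment vector. -/

section TensorVector

variable {a e : Type*}

/-- The operator `x ↦ x ⊗ ψ`. -/
def tensorVector [DecidableEq a] (ψ : e → ℂ) : Matrix (a × e) a ℂ :=
  Matrix.of fun x j => if x.1 = j then ψ x.2 else 0

/-- The environment is uncorrelated with the input, so only the trace survives and traceless inputs
are annihilated. -/
lemma complementaryChannel_tensorVector [Fintype a] [DecidableEq a] (ψ : e → ℂ) (ρ : Matrix a a ℂ) :
    complementaryChannel (tensorVector ψ) ρ = ρ.trace • Matrix.vecMulVec ψ (star ψ) := by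
  ext k l
  simp [complementaryChannel, partialTraceFst, tensorVector, Matrix.mul_apply,
    Matrix.vecMulVec_apply, Matrix.trace, Finset.sum_mul, apply_ite]
  exact Finset.sum_congr rfl fun _ _ => by ring

end TensorVector

/-! ### From closeness to the identity to an almost constant environment. -/

section InformationDisturbance

open scoped Matrix.Norms.L2Operator

variable {a b e : Type*} [Fintype a] [Fintype e]

/-- The Kraus operators of the channel with isometric extension `V`. -/
def krausOperator (V : Matrix (b × e) a ℂ) (k : e) : Matrix b a ℂ :=
  Matrix.of fun i j => V (i, k) j

lemma trace_ampliation [Fintype b] {N : Matrix a a ℂ →ₗ[ℂ] Matrix b b ℂ}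
    (hN : ∀ M, (N M).trace = M.trace) (n : ℕ) (M : Matrix (Fin n × a) (Fin n × a) ℂ) :
    (ampliation n N M).trace = M.trace := by
  have h : ∀ r, (N (Matrix.of fun p q => M (r, p) (r, q))).trace = ∑ p, M (r, p) (r, p) :=
    fun r => hN _
  simp only [Matrix.trace, Matrix.diag_apply, Fintype.sum_prod_type, ampliation,
    Matrix.of_apply] at h ⊢
  exact Finset.sum_congr rfl fun r _ => h r

/-- A matrix `D` is read as a vector of `ℂⁿ ⊗ H_A`, on which `1 ⊗ K` acts as `D ↦ K * D`. -/
lemma ampliation_vecMulVec {N : Matrix a a ℂ →ₗ[ℂ] Matrix b b ℂ} {V : Matrix (b × e) a ℂ}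
    (hV : ∀ ρ, N ρ = partialTraceSnd (V * ρ * Vᴴ)) {n : ℕ} (D : Matrix a (Fin n) ℂ) :
    ampliation n N (Matrix.vecMulVec (fun x => D x.2 x.1) (star fun x => D x.2 x.1)) =
      ∑ k, Matrix.vecMulVec (fun x => (krausOperator V k * D) x.2 x.1)
        (star fun x => (krausOperator V k * D) x.2 x.1) := by
  ext ⟨r, i⟩ ⟨s, j⟩
  simp only [ampliation, hV, partialTraceSnd, Matrix.of_apply, Matrix.sum_apply, Matrix.mul_apply,
    Matrix.vecMulVec_apply, Pi.star_apply, krausOperator, Matrix.conjTranspose_apply, star_sum,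
    star_mul', Finset.sum_mul, Finset.mul_sum]
  refine Finset.sum_congr rfl fun k _ => ?_
  refine Finset.sum_congr rfl fun p _ => Finset.sum_congr rfl fun q _ => ?_
  ring

lemma dotProduct_star_mul_eq_trace {c : Type*} [Fintype c] (K : Matrix a a ℂ) (D : Matrix a c ℂ) :
    (star fun x : c × a => D x.2 x.1) ⬝ᵥ (fun x => (K * D) x.2 x.1) = (K * (D * Dᴴ)).trace := by
  rw [← Matrix.mul_assoc]
  simp only [Matrix.trace, Matrix.diag_apply, Matrix.mul_apply (M := K * D), dotProduct,
    Fintype.sum_prod_type_right, Pi.star_apply, Matrix.conjTranspose_apply]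
  exact Finset.sum_congr rfl fun _ _ => Finset.sum_congr rfl fun _ _ => mul_comm _ _

lemma sum_sq_mulVec_of_isometry {m : Type*} [Fintype m] [DecidableEq a] {V : Matrix m a ℂ}
    (hV : Vᴴ * V = 1) (x : a → ℂ) : ∑ p, ‖(V *ᵥ x) p‖ ^ 2 = ∑ j, ‖x j‖ ^ 2 := by
  have h : star (V *ᵥ x) ⬝ᵥ (V *ᵥ x) = star x ⬝ᵥ x := by
    rw [Matrix.star_mulVec, ← Matrix.dotProduct_mulVec, Matrix.mulVec_mulVec, hV, Matrix.one_mulVec]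
  simp only [dotProduct, Pi.star_apply, RCLike.star_def, RCLike.conj_mul] at h
  exact_mod_cast h

/-- A channel close to the identity has entanglement fidelity close to one on every state. -/
lemma one_sub_le_sum_norm_sq_trace_kraus [DecidableEq a] {N : Matrix a a ℂ →ₗ[ℂ] Matrix a a ℂ}
    {V : Matrix (a × e) a ℂ} (hN : ∀ M, (N M).trace = M.trace)
    (hV : ∀ ρ, N ρ = partialTraceSnd (V * ρ * Vᴴ)) {ε : ℝ} (hε : 0 ≤ ε)
    (hclose : diamondNorm (N - LinearMap.id) ≤ ENNReal.ofReal ε)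
    {ρ : Matrix a a ℂ} (hρ : ρ.PosSemidef) (htr : ρ.trace = 1) :
    1 - ε / 2 ≤ ∑ k, ‖(krausOperator V k * ρ).trace‖ ^ 2 := by
  obtain ⟨B, rfl⟩ := CStarAlgebra.nonneg_iff_eq_star_mul_self.1 (Matrix.nonneg_iff_posSemidef.2 hρ)
  rw [Matrix.star_eq_conjTranspose] at *
  set f := Fintype.equivFin a
  set n := Fintype.card a
  -- As a vector, `D` purifies `ρ = D * Dᴴ`; columns are reindexed by `Fin n` to match the ancilla
  -- of the diamond norm.
  set D : Matrix a (Fin n) ℂ := Bᴴ.submatrix id f.symm with hD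
  have hDD : Bᴴ * B = D * Dᴴ := by
    rw [hD, Matrix.conjTranspose_submatrix, Matrix.conjTranspose_conjTranspose,
      Matrix.submatrix_mul_equiv, Matrix.submatrix_id_id]
  rw [hDD] at htr ⊢
  set φ : Fin n × a → ℂ := fun x => D x.2 x.1 with hφ
  set M := Matrix.vecMulVec φ (star φ) with hM
  have hφφ : star φ ⬝ᵥ φ = 1 := by
    have h := dotProduct_star_mul_eq_trace 1 D
    rwa [Matrix.one_mul, Matrix.one_mul, htr] at h
  have hMM : M * M = M := by
    rw [hM, Matrix.vecMulVec_mul_vecMulVec, hφφ, one_smul]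
  have hMpos : M.PosSemidef := Matrix.posSemidef_vecMulVec_self_star φ
  have hMtr : M.trace = 1 := by
    rw [hM, Matrix.trace_vecMulVec, dotProduct_comm, hφφ]
  have hMnorm : traceNorm M = 1 := by
    rw [traceNorm_of_posSemidef hMpos, hMtr, Complex.one_re]
  set F : ℝ := ∑ k, ‖(krausOperator V k * (D * Dᴴ)).trace‖ ^ 2 with hF
  have hfid : (M * ampliation n N M).trace = F := by
    rw [hM, hφ, ampliation_vecMulVec hV, ← hφ, Matrix.mul_sum, Matrix.trace_sum, hF,
      Complex.ofReal_sum]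
    refine Finset.sum_congr rfl fun k _ => ?_
    rw [Matrix.vecMulVec_mul_vecMulVec, Matrix.trace_vecMulVec, dotProduct_smul,
      hφ, dotProduct_star_mul_eq_trace, ← hφ, smul_eq_mul]
    have h2 : φ ⬝ᵥ star (fun x : Fin n × a => (krausOperator V k * D) x.2 x.1) =
        star ((krausOperator V k * (D * Dᴴ)).trace) := by
      rw [← dotProduct_star_mul_eq_trace, Matrix.star_dotProduct, star_star, ← hφ, dotProduct_comm]
    rw [h2, RCLike.star_def, RCLike.mul_conj]
    norm_cast
  -- Testing with the reflection `1 - 2M` instead of `M` gives `2(1 - F)`, hence `ε / 2` rather than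
  -- `ε`.
  have hZ : ‖(1 : Matrix (Fin n × a) (Fin n × a) ℂ) - (2 : ℂ) • M‖ ≤ 1 := by
    have hsq : (1 - (2 : ℂ) • M)ᴴ * (1 - (2 : ℂ) • M) = 1 := by
      rw [Matrix.conjTranspose_sub, Matrix.conjTranspose_smul, hMpos.1.eq, Matrix.conjTranspose_one,
        Matrix.sub_mul, Matrix.mul_sub, Matrix.mul_sub, Matrix.mul_smul, Matrix.mul_smul,
        Matrix.smul_mul, Matrix.smul_mul, hMM]
      simp only [one_mul, mul_one, star_ofNat]
      module
    refine l2_opNorm_le_of_sum_sq_le zero_le_one fun x => ?_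
    rw [sum_sq_mulVec_of_isometry hsq, one_pow, one_mul]
  have h1 := norm_trace_mul_le (1 - (2 : ℂ) • M) (ampliation n (N - LinearMap.id) M)
  have h2 := traceNorm_ampliation_le_of_diamondNorm_le hε hclose n M
  have h3 : ((1 - (2 : ℂ) • M) * ampliation n (N - LinearMap.id) M).trace =
      ((2 * (1 - F) : ℝ) : ℂ) := by
    rw [ampliation_sub, ampliation_id, Matrix.sub_mul, one_mul, Matrix.smul_mul, Matrix.mul_sub,
      hMM, Matrix.trace_sub, Matrix.trace_sub, Matrix.trace_smul, Matrix.trace_sub, hfid,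
      trace_ampliation hN, hMtr, smul_eq_mul]
    push_cast
    ring
  rw [h3, Complex.norm_real] at h1
  rw [hMnorm, mul_one] at h2
  have h4 := le_abs_self (2 * (1 - F))
  have h5 := mul_le_mul_of_nonneg_right hZ
    (traceNorm_nonneg (ampliation n (N - LinearMap.id) M))
  rw [Real.norm_eq_abs] at h1
  linarith

/-- For a channel close to the identity, one vector of the unit ball of the environment correlates
with the Kraus operators uniformly over all states. -/
lemma exists_environment_vector [DecidableEq a] {N : Matrix a a ℂ →ₗ[ℂ] Matrix a a ℂ}
    {V : Matrix (a × e) a ℂ} (hN : ∀ M, (N M).trace = M.trace)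
    (hV : ∀ ρ, N ρ = partialTraceSnd (V * ρ * Vᴴ)) {ε : ℝ} (hε : 0 ≤ ε)
    (hclose : diamondNorm (N - LinearMap.id) ≤ ENNReal.ofReal ε) :
    ∃ ψ : e → ℂ, ∑ k, ‖ψ k‖ ^ 2 ≤ 1 ∧ ∀ ρ : Matrix a a ℂ, ρ.PosSemidef →
      (1 - ε / 2) * ρ.trace.re ≤ (∑ k, star (ψ k) * (krausOperator V k * ρ).trace).re := by
  set ξ : Matrix a a ℂ →ₗ[ℝ] EuclideanSpace ℂ e :=
    { toFun := fun ρ => WithLp.toLp 2 fun k => (krausOperator V k * ρ).trace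
      map_add' := fun ρ σ => by
        ext k
        simp [Matrix.mul_add]
      map_smul' := fun c ρ => by
        ext k
        simp } with hξ
  set S : Set (Matrix a a ℂ) := {ρ | ρ.PosSemidef ∧ ρ.trace = 1} with hS
  have hSconv : Convex ℝ S := by
    rintro ρ ⟨hρ, hρ1⟩ σ ⟨hσ, hσ1⟩ s t hs ht hst
    refine ⟨(hρ.smul hs).add (hσ.smul ht), ?_⟩
    rw [Matrix.trace_add, Matrix.trace_smul, Matrix.trace_smul, hρ1, hσ1, ← add_smul, hst, one_smul]
  have hzero : ∀ ρ : Matrix a a ℂ, ρ.PosSemidef → ρ.trace.re = 0 → ρ = 0 := fun ρ hρ h =>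
    eq_zero_of_traceNorm_eq_zero ((traceNorm_of_posSemidef hρ).trans h)
  have hnormalize : ∀ ρ : Matrix a a ℂ, ρ.PosSemidef → ρ.trace.re ≠ 0 →
      (ρ.trace.re)⁻¹ • ρ ∈ S := by
    intro ρ hρ h
    have h1 : ((ρ.trace.re : ℝ) : ℂ) = ρ.trace := by
      have := (Complex.nonneg_iff.1 hρ.trace_nonneg).2
      exact Complex.ext rfl (by simpa using this)
    refine ⟨hρ.smul (inv_nonneg.2 (Complex.nonneg_iff.1 hρ.trace_nonneg).1), ?_⟩
    rw [Matrix.trace_smul, Complex.real_smul, Complex.ofReal_inv, h1]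
    refine inv_mul_cancel₀ fun h0 => h ?_
    rw [h0, Complex.zero_re]
  obtain ⟨ψ, hψ1, hψ⟩ : ∃ ψ : EuclideanSpace ℂ e, ‖ψ‖ ≤ 1 ∧
      ∀ x ∈ ξ '' S, 1 - ε / 2 ≤ inner ℝ ψ x := by
    -- There may be no states at all, when `H_A = 0`.
    rcases S.eq_empty_or_nonempty with h | h
    · exact ⟨0, by simp, by simp [h]⟩
    · refine exists_norm_le_one_forall_le_inner (h.image _) (hSconv.linear_image ξ) (by linarith) ?_
      rintro _ ⟨ρ, ⟨hρ, hρ1⟩, rfl⟩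
      rw [EuclideanSpace.norm_sq_eq]
      exact one_sub_le_sum_norm_sq_trace_kraus hN hV hε hclose hρ hρ1
  have hinner : ∀ ρ, inner ℝ ψ (ξ ρ) =
      (∑ k, star (ψ k) * (krausOperator V k * ρ).trace).re := by
    intro ρ
    rw [PiLp.inner_apply, Complex.re_sum]
    simp [hξ, Complex.inner, mul_comm]
  refine ⟨ψ, ?_, fun ρ hρ => ?_⟩
  · rw [← EuclideanSpace.norm_sq_eq]
    exact pow_le_one₀ (norm_nonneg _) hψ1
  · by_cases h : ρ.trace.re = 0
    · simp [hzero ρ hρ h]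
    · have h1 := hψ _ ⟨_, hnormalize ρ hρ h, rfl⟩
      have hpos : 0 < ρ.trace.re :=
        lt_of_le_of_ne (Complex.nonneg_iff.1 hρ.trace_nonneg).1 (Ne.symm h)
      rwa [map_smul, real_inner_smul_right, inv_mul_eq_div, le_div_iff₀ hpos, hinner] at h1

lemma sum_sq_tensorVector_mulVec [DecidableEq a] (ψ : e → ℂ) (x : a → ℂ) :
    ∑ p, ‖((tensorVector ψ : Matrix (a × e) a ℂ) *ᵥ x) p‖ ^ 2 =
      (∑ k, ‖ψ k‖ ^ 2) * ∑ j, ‖x j‖ ^ 2 := by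
  simp [tensorVector, Matrix.mulVec, dotProduct, Fintype.sum_prod_type, mul_pow, Finset.sum_mul_sum]
  exact Finset.sum_comm

/-- An isometric extension of a channel close to the identity is close to `x ↦ x ⊗ ψ`. -/
lemma exists_tensorVector_close [DecidableEq a] {N : Matrix a a ℂ →ₗ[ℂ] Matrix a a ℂ}
    {V : Matrix (a × e) a ℂ} (hN : ∀ M, (N M).trace = M.trace)
    (hV : IsIsometricExtension N V) {ε : ℝ} (hε : 0 ≤ ε)
    (hclose : diamondNorm (N - LinearMap.id) ≤ ENNReal.ofReal ε) :
    ∃ ψ : e → ℂ, ‖(tensorVector ψ : Matrix (a × e) a ℂ)‖ ≤ 1 ∧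
      ‖V - tensorVector ψ‖ ≤ Real.sqrt ε := by
  obtain ⟨ψ, hψ1, hψ⟩ := exists_environment_vector hN hV.dilation hε hclose
  refine ⟨ψ, ?_, ?_⟩
  · refine l2_opNorm_le_of_sum_sq_le zero_le_one fun x => ?_
    rw [sum_sq_tensorVector_mulVec, one_pow]
    exact mul_le_mul_of_nonneg_right hψ1 (Finset.sum_nonneg fun _ _ => by positivity)
  · refine l2_opNorm_le_of_sum_sq_le (Real.sqrt_nonneg _) fun x => ?_
    rw [Real.sq_sqrt hε]
    set W : Matrix (a × e) a ℂ := tensorVector ψ with hW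
    have hx : 0 ≤ ∑ j, ‖x j‖ ^ 2 := Finset.sum_nonneg fun _ _ => by positivity
    have h1 := hψ _ (Matrix.posSemidef_vecMulVec_self_star x)
    have htr : (Matrix.vecMulVec x (star x)).trace.re = ∑ j, ‖x j‖ ^ 2 := by
      rw [Matrix.trace_vecMulVec]
      simp only [dotProduct, Pi.star_apply, RCLike.star_def, RCLike.mul_conj]
      norm_cast
    have hcross : ∑ k, star (ψ k) * (krausOperator V k * Matrix.vecMulVec x (star x)).trace =
        ∑ p, star ((W *ᵥ x) p) * (V *ᵥ x) p := by
      have hWx : ∀ p, (W *ᵥ x) p = ψ p.2 * x p.1 := fun p => by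
        simp [hW, tensorVector, Matrix.mulVec, dotProduct]
      rw [Fintype.sum_prod_type_right]
      refine Finset.sum_congr rfl fun k _ => ?_
      rw [Matrix.mul_vecMulVec, Matrix.trace_vecMulVec, dotProduct, Finset.mul_sum]
      refine Finset.sum_congr rfl fun i _ => ?_
      rw [hWx, star_mul']
      simp only [krausOperator, Matrix.mulVec, dotProduct, Matrix.of_apply, Pi.star_apply]
      ring
    have hexp : ∑ p, ‖((V - W) *ᵥ x) p‖ ^ 2 = ∑ p, ‖(V *ᵥ x) p‖ ^ 2 + ∑ p, ‖(W *ᵥ x) p‖ ^ 2 -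
        2 * (∑ p, star ((W *ᵥ x) p) * (V *ᵥ x) p).re := by
      rw [Complex.re_sum, Finset.mul_sum, ← Finset.sum_add_distrib, ← Finset.sum_sub_distrib]
      refine Finset.sum_congr rfl fun p _ => ?_
      rw [Matrix.sub_mulVec, Pi.sub_apply]
      simp only [Complex.sq_norm, Complex.normSq_apply, Complex.sub_re, Complex.sub_im,
        RCLike.star_def, Complex.mul_re, Complex.conj_re, Complex.conj_im]
      ring
    rw [htr, hcross] at h1
    rw [hexp, sum_sq_mulVec_of_isometry hV.isometry, hW, sum_sq_tensorVector_mulVec, ← hW]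
    -- The squared distance is at most `(1 + 1 - 2(1 - ε/2))‖x‖² = ε‖x‖²`.
    nlinarith [mul_le_mul_of_nonneg_right hψ1 hx]

end InformationDisturbance

/-! ### The factorization and the final bound. -/

section Main

open scoped Matrix.Norms.L2Operator

variable {a e : Type*} [Fintype a] [DecidableEq a] [Fintype e] [DecidableEq e]

lemma diamondNorm_complementaryChannel_sub_comp_le {N : Matrix a a ℂ →ₗ[ℂ] Matrix a a ℂ}
    {V : Matrix (a × e) a ℂ} (hN : ∀ M, (N M).trace = M.trace)
    (hV : IsIsometricExtension N V) {ε : ℝ} (hε : 0 ≤ ε)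
    (hclose : diamondNorm (N - LinearMap.id) ≤ ENNReal.ofReal ε) :
    diamondNorm (complementaryChannel V - complementaryChannel V ∘ₗ N) ≤
      ENNReal.ofReal (2 * ε ^ (3 / 2 : ℝ)) := by
  obtain ⟨ψ, hψ, hVψ⟩ := exists_tensorVector_close hN hV hε hclose
  have hV1 : ‖V‖ ≤ 1 := l2_opNorm_le_of_sum_sq_le zero_le_one fun x => by
    rw [sum_sq_mulVec_of_isometry hV.isometry, one_pow, one_mul]
  -- The `ψ`-term can be inserted for free, as it vanishes on the traceless range of `N - id`.
  have hfactor : complementaryChannel V - complementaryChannel V ∘ₗ N =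
      -((complementaryChannel V - complementaryChannel (tensorVector ψ)) ∘ₗ
        (N - LinearMap.id)) := by
    refine LinearMap.ext fun ρ => ?_
    simp only [LinearMap.sub_apply, LinearMap.comp_apply, LinearMap.neg_apply, LinearMap.id_apply,
      complementaryChannel_tensorVector, hN, map_sub]
    abel
  refine iSup_le fun n => iSup_le fun M => iSup_le fun hM => ENNReal.ofReal_le_ofReal ?_
  rw [hfactor, ampliation_neg, traceNorm_neg, ampliation_comp]
  refine (traceNorm_ampliation_complementaryChannel_sub_le hV1 hψ hVψ n _).trans ?_
  have h1 := traceNorm_ampliation_le_of_diamondNorm_le hε hclose n M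
  rw [hM, mul_one] at h1
  refine (mul_le_mul_of_nonneg_left h1 (by positivity)).trans_eq ?_
  rw [mul_assoc, Real.sqrt_eq_rpow]
  -- Splitting `ε ^ (3/2)` by `Real.rpow_add` needs a positive base.
  rcases hε.eq_or_lt with rfl | hpos
  · norm_num
  · rw [show (3 / 2 : ℝ) = 1 / 2 + 1 by norm_num, Real.rpow_add hpos, Real.rpow_one]

end Main

theorem theorem3p3 {a e : Type*} [Fintype a] [DecidableEq a] [Fintype e] [DecidableEq e]
    (N : Matrix a a ℂ →ₗ[ℂ] Matrix a a ℂ) (hN : IsQuantumChannel N)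
    (V : Matrix (a × e) a ℂ) (hV : IsIsometricExtension N V)
    (ε : ℝ) (hε : ε ∈ Set.Icc (0 : ℝ) 2)
    (hclose : diamondNorm (N - LinearMap.id) ≤ ENNReal.ofReal ε) :
    IsQuantumChannel (complementaryChannel V) ∧
      diamondNorm (complementaryChannel V - complementaryChannel V ∘ₗ N) ≤
        ENNReal.ofReal (2 * ε ^ (3 / 2 : ℝ)) ∧
      IsApproxDegradable N (complementaryChannel V) (ENNReal.ofReal (2 * ε ^ (3 / 2 : ℝ))) ∧
      degradabilityParameter N (complementaryChannel V) ≤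
        ENNReal.ofReal (2 * ε ^ (3 / 2 : ℝ)) := by

  have hc := isQuantumChannel_complementaryChannel hV.isometry
  have hd := diamondNorm_complementaryChannel_sub_comp_le hN.tracePreserving hV hε.1 hclose
  exact ⟨hc, hd, ⟨_, hc, hd⟩, sInf_le ⟨_, hc, hd⟩⟩
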